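/- Let $\mathcal H$ be a complex Hilbert space, $\mathcal D\subset\mathcal H$ a dense subspace, and $\mathcal M$ an $O^*$-algebra on $\mathcal D$ containing the identity, i.e. a unital subalgebra of the algebra of linear operators $\mathcal D\to\mathcal D$ such that for every $\hat A\in\mathcal M$ the adjoint $\hat A^*$ is defined on $\mathcal D$, maps $\mathcal D$ into $\mathcal D$, and $\hat A^*|_{\mathcal D}\in\mathcal M$. Let $\mathcal E$ be the set of density operators $\hat\rho$ (positive, trace class, $\mathrm{Tr}\,\hat\rho=1$) with $\hat\rho\mathcal H\subset\mathcal D$ and $\hat B\hat\rho$ trace class for all $\hat B\in\mathcal M$, with the weakest topology making all functions $\hat\rho\mapsto\mathrm{Tr}(\hat B\hat\rho)$, $\hat B\in\mathcal M$, continuous. A qr-number is a continuous real function $s$ on an open set $U\subset\mathcal E$ (its extent). It is locally linear if each point of $U$ has an open neighbourhood on which $s$ equals $\hat\rho\mapsto\mathrm{Tr}(\hat B\hat\rho)$ for some essentially self-adjoint $\hat B\in\mathcal M$. For qr-numbers $s$ on $U$ and $t$ on $V$, the distance $|s-t|$ is the function equal to $|s(\hat\rho)-t(\hat\rho)|$ on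 $U\cap V$, to $|s(\hat\rho)|$ on $\mathrm{int}(U\setminus V)$, to $|t(\hat\rho)|$ on $\mathrm{int}(V\setminus U)$, and to $0$ on $\mathrm{int}(\mathcal E\setminus(U\cup V))$; $|s-t|<\epsilon$ means that all its values are less than $\epsilon$. A sequence $(s_k)$ is Cauchy if for every real $\epsilon>0$ there is $K$ with $|s_k-s_{k'}|<\epsilon$ for all $k,k'>K$, and converges to $t$ if for every $\epsilon>0$ there is $K$ with $|s_k-t|<\epsilon$ for all $k>K$. Let $\hat A\in\mathcal M$ be essentially self-adjoint. For $V\subset\mathcal E$ open let $a_Q(V)$ be the function $\hat\rho\mapsto\mathrm{Tr}(\hat A\hat\rho)$ on $V$ and, for $F:\mathbb R\to\mathbb R$ continuous, let $F(a_Q(V))$ be its composition with $F$, again on $V$. (1) If $(V_k)$ is a sequence of open subsets of $\mathcal E$ for which $(a_Q(V_k))$ is Cauchy, then there is an open (possibly empty) set $W\subset\mathcal E$ such that $a_Q(W)$ is locally linear, $(a_Q(V_k))$ converges to $a_Q(W)$, and, for every continuous $F:\mathbb R\to\mathbb R$ such that $(F(a_Q(V_k)))$ is Cauchy, $(F(a_Q(V_k)))$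 converges to $F(a_Q(W))$. (2) If $\hat A\neq0$, then for all open sets $V_k,W\subset\mathcal E$ and every continuous $F:\mathbb R\to\mathbb R$: if $(a_Q(V_k))$ converges to $a_Q(W)$ and $(F(a_Q(V_k)))$ is Cauchy, then $(F(a_Q(V_k)))$ converges to $F(a_Q(W))$. -/

import Mathlib

open Set Filter Topology TopologicalSpace
open scoped InnerProductSpace

namespace QR

noncomputable section

/-! ### Trace class operators -/

section Operators

variable {H : Type*} [NormedAddCommGroup H] [InnerProductSpace ℂ H] [CompleteSpace H]

/-- A bounded operator `T` is trace class iff `Tr |T| < ∞`, where `|T| = (T* T)^(1/2)`.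
(Every orthonormal basis is, up to indexing, indexed by a subset of `H`.) -/
def IsTraceClass (T : H →L[ℂ] H) : Prop :=
  ∀ (w : Set H) (b : HilbertBasis w ℂ H),
    Summable fun i => (⟪b i, (CFC.abs T) (b i)⟫_ℂ).re

/-- An everywhere defined linear operator that is bounded and trace class. -/
def IsTraceClassLin (T : H →ₗ[ℂ] H) : Prop :=
  ∃ S : H →L[ℂ] H, (∀ x, S x = T x) ∧ IsTraceClass S

variable (H) in
/-- The index set of a fixed orthonormal basis of `H`. -/
def basisIndex : Set H := (exists_hilbertBasis ℂ H).choose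

variable (H) in
/-- A fixed orthonormal basis of `H`. -/
def stdBasis : HilbertBasis (basisIndex H) ℂ H := (exists_hilbertBasis ℂ H).choose_spec.choose

/-- The trace of an operator (meaningful for trace class operators, for which the sum converges
absolutely and does not depend on the basis). -/
def trace (T : H →ₗ[ℂ] H) : ℂ := ∑' i, ⟪stdBasis H i, T (stdBasis H i)⟫_ℂ

end Operators

/-! ### O*-algebras and their states -/

variable {H : Type*} [NormedAddCommGroup H] [InnerProductSpace ℂ H] [CompleteSpace H]

/-- A (unital) O*-algebra on the subspace `D` of `H` (assumed dense where it is used): a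
subalgebra with identity of the algebra of linear operators `D → D`, such that for every `A` in it
the Hilbert space adjoint `A*` is defined on `D`, and `A†`, the restriction of `A*` to `D`, maps
`D` into `D` and belongs to the algebra again. -/
structure OStarAlgebra (D : Submodule ℂ H) where
  /-- the underlying unital algebra of operators -/
  carrier : Subalgebra ℂ (Module.End ℂ D)
  exists_dagger : ∀ A ∈ carrier, ∃ B ∈ carrier,
    ∀ φ ψ : D, ⟪((A φ : D) : H), (ψ : H)⟫_ℂ = ⟪(φ : H), ((B ψ : D) : H)⟫_ℂ

variable {D : Submodule ℂ H}

/-- An operator `A : D → D` as a partially defined operator in `H` with domain `D`. -/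
def toLinearPMap (A : Module.End ℂ D) : H →ₗ.[ℂ] H := ⟨D, D.subtype ∘ₗ A⟩

/-- `A : D → D` is essentially self-adjoint: its closure is a self-adjoint operator in `H`. -/
def IsEssSelfAdjoint (A : Module.End ℂ D) : Prop :=
  (toLinearPMap A).IsClosable ∧ IsSelfAdjoint (toLinearPMap A).closure

/-- The product `A T : H → H`, for `T : H → H` with range in `D` and `A : D → D`. -/
def mulOp (A : Module.End ℂ D) (T : H →L[ℂ] H) (hT : ∀ x, T x ∈ D) : H →ₗ[ℂ] H :=
  D.subtype ∘ₗ A ∘ₗ ((T : H →ₗ[ℂ] H).codRestrict D hT)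

/-- The set `T₁(M)`: trace class operators `T` with `T H ⊆ D`, `T* H ⊆ D` such that `A T` and
`A T*` are trace class for every `A` in `M`. -/
structure MemT1 (M : OStarAlgebra D) (T : H →L[ℂ] H) : Prop where
  traceClass : IsTraceClass T
  range_mem : ∀ x, T x ∈ D
  adjoint_range_mem : ∀ x, ContinuousLinearMap.adjoint T x ∈ D
  mul_traceClass : ∀ A ∈ M.carrier, IsTraceClassLin (mulOp A T range_mem)
  mul_adjoint_traceClass : ∀ A ∈ M.carrier,
    IsTraceClassLin (mulOp A (ContinuousLinearMap.adjoint T) adjoint_range_mem)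

/-- The state space of `M`: density operators (positive operators of trace one) in `T₁(M)`. -/
structure StateSpace (M : OStarAlgebra D) where
  /-- the density operator -/
  op : H →L[ℂ] H
  memT1 : MemT1 M op
  isPositive : op.IsPositive
  trace_eq_one : trace (op : H →ₗ[ℂ] H) = 1

/-- `Tr (A ρ)`, for `A` in `M` and a state `ρ`. -/
def expect {M : OStarAlgebra D} (ρ : StateSpace M) (A : M.carrier) : ℂ :=
  trace (mulOp (A : Module.End ℂ D) ρ.op ρ.memT1.range_mem)

/-- The weak topology: the coarsest one for which `ρ ↦ Tr (A ρ)` is continuous for all `A` in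
`M`. -/
instance instTopologicalSpaceStateSpace (M : OStarAlgebra D) : TopologicalSpace (StateSpace M) :=
  TopologicalSpace.induced (fun ρ => (expect ρ : M.carrier → ℂ)) inferInstance

/-- The function `a_Q(ρ) = Tr (A ρ)` (the trace is real when `A` is essentially self-adjoint). -/
def aQ {M : OStarAlgebra D} (A : M.carrier) : C(StateSpace M, ℝ) where
  toFun ρ := (expect ρ A).re
  continuous_toFun := by
    have h : Continuous (fun ρ : StateSpace M => (expect ρ : M.carrier → ℂ)) :=
      continuous_induced_dom
    exact Complex.continuous_re.comp ((continuous_apply A).comp h)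

/-! ### Dedekind real numbers of a space, as continuous functions on open sets -/

section Reals

/-- A Dedekind real number in the topos of sheaves on `X`, defined to an open extent: a continuous
real function on an open subset of `X`. For `X` the state space these are the qr-numbers. -/
structure RealNumber (X : Type*) [TopologicalSpace X] where
  /-- the extent to which the number is defined -/
  extent : Opens X
  /-- the section over the extent -/
  toFun : C(extent, ℝ)

variable {X : Type*} [TopologicalSpace X]

/-- The number `h(V)`, the restriction to an open set `V` of a continuous function `h` on `X`. -/
def restrictTo (h : C(X, ℝ)) (V : Opens X) : RealNumber X := ⟨V, h.restrict (V : Set X)⟩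

namespace RealNumber

/-- `F(s)`, defined to the same extent as `s`. -/
def map (F : C(ℝ, ℝ)) (s : RealNumber X) : RealNumber X := ⟨s.extent, F.comp s.toFun⟩

open Classical in
/-- The prolongation of `s` by zero to all of `X`. -/
def prolong (s : RealNumber X) (x : X) : ℝ := if hx : x ∈ s.extent then s.toFun ⟨x, hx⟩ else 0

/-- The pointwise distance `|s - t|`: it is `|s - t|` on the common extent, `|s|` where only `s`
is defined, `|t|` where only `t` is defined, and zero elsewhere. -/
def distFun (s t : RealNumber X) (x : X) : ℝ := |s.prolong x - t.prolong x|

/-- The open set on which the number `|s - t|` is defined. A continuous function on an arbitrary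
set `S` determines a number to extent `interior S`; this is applied to each of the four pieces on
which `|s - t|` is given by one of the four formulas. -/
def distExtent (s t : RealNumber X) : Set X :=
  interior ((s.extent : Set X) ∩ t.extent) ∪ interior ((s.extent : Set X) \ t.extent) ∪
    interior ((t.extent : Set X) \ s.extent) ∪ interior ((s.extent : Set X) ∪ t.extent)ᶜ

/-- `|s - t| < ε` as numbers. -/
def DistLT (s t : RealNumber X) (ε : ℝ) : Prop := ∀ x ∈ distExtent s t, distFun s t x < ε

/-- Cauchy sequences of numbers. -/
def IsCauchy (s : ℕ → RealNumber X) : Prop :=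
  ∀ ε : ℝ, 0 < ε → ∃ K : ℕ, ∀ k k' : ℕ, K < k → K < k' → DistLT (s k) (s k') ε

/-- Convergence of a sequence of numbers. -/
def ConvergesTo (s : ℕ → RealNumber X) (t : RealNumber X) : Prop :=
  ∀ ε : ℝ, 0 < ε → ∃ K : ℕ, ∀ k : ℕ, K < k → DistLT (s k) t ε

end RealNumber

end Reals

/-- A qr-number `s` is locally linear if each point of its extent has an open neighbourhood on
which `s` coincides with `b_Q` for some essentially self-adjoint `B` in `M`. -/
def IsLocallyLinear {M : OStarAlgebra D} (s : RealNumber (StateSpace M)) : Prop :=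
  ∀ ρ ∈ s.extent, ∃ U : Opens (StateSpace M), ρ ∈ U ∧ U ≤ s.extent ∧
    ∃ B : M.carrier, IsEssSelfAdjoint (B : Module.End ℂ D) ∧
      ∀ (σ : StateSpace M) (_ : σ ∈ U) (hs : σ ∈ s.extent), s.toFun ⟨σ, hs⟩ = aQ B σ

end

end QR

/-! Boundaries of extents are invisible to the distance: `|a(U) - a(V)| < ε` says only that `|a| <
ε` on the part of each set outside the closure of the other. So everything becomes a question about
open sets and a continuous function `a`.

If `A ≠ 0`, then `a_Q ≠ 0` on a dense set (`dense_aQ_ne_zero`): the state space is convex and `a_Q`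
is affine, so vanishing on a nonempty open set forces vanishing everywhere, hence on vector states,
hence `A = 0`. Wherever `a ≠ 0`, convergence of `a(V_k)` controls the extents, and a Cauchy
`F(a(V_k))` must then have limit `F(a(W))` (`ConvergesTo.of_isCauchy`). The set `W` glues pieces of
the `V_k` on which `|a|` exceeds smaller and smaller bounds (`IsCauchy.exists_convergesTo`).

If `A = 0`, every `W` is a limit of `a(V_k)`, and one must be picked that serves all `F` at once. -/

namespace QR

/-! ### Trace class operators form a space on which the trace is linear. -/

section TraceClass

variable {H : Type*} [NormedAddCommGroup H] [InnerProductSpace ℂ H] [CompleteSpace H]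

/-- Douglas factorisation: a bounded operator dominated in norm by `e` factors through `e`. -/
theorem exists_factor_of_norm_le (f e : H →L[ℂ] H) (h : ∀ x, ‖f x‖ ≤ ‖e x‖) :
    ∃ U : H →L[ℂ] H, ∀ x, f x = U (e x) := by
  set S : Submodule ℂ H := e.range.topologicalClosure with hS
  have hmem : ∀ x, e x ∈ S := fun x => e.range.le_topologicalClosure ⟨x, rfl⟩
  let e' : H →ₗ[ℂ] S := (e : H →ₗ[ℂ] H).codRestrict S hmem
  have hdense : DenseRange e' := by
    intro y
    rw [Metric.mem_closure_iff]
    intro ε hε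
    have hy : (y : H) ∈ closure (e.range : Set H) := y.2
    obtain ⟨_, ⟨x, rfl⟩, hx⟩ := Metric.mem_closure_iff.1 hy ε hε
    exact ⟨e' x, ⟨x, rfl⟩, hx⟩
  have hS_closed : IsClosed (S : Set H) := e.range.isClosed_topologicalClosure
  have : CompleteSpace S := hS_closed.completeSpace_coe
  -- `e x ↦ f x` is a contraction on the range of `e`; it extends to the closure, and by zero to the
  -- orthogonal complement.
  refine ⟨((f : H →ₗ[ℂ] H).extendOfNorm e') ∘L S.orthogonalProjectionOnto, fun x => ?_⟩
  have hp : S.orthogonalProjectionOnto (e x) = e' x :=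
    S.orthogonalProjectionOnto_mem_subspace_eq_self ⟨e x, hmem x⟩
  have := LinearMap.extendOfNorm_eq (f := (f : H →ₗ[ℂ] H)) hdense ⟨1, fun x => by
    rw [one_mul]; exact h x⟩ x
  simp only [ContinuousLinearMap.comp_apply, hp]
  exact this.symm

theorem norm_abs_apply (T : H →L[ℂ] H) (x : H) : ‖CFC.abs T x‖ = ‖T x‖ := by
  have hsa : ContinuousLinearMap.adjoint (CFC.abs T) = CFC.abs T :=
    (IsSelfAdjoint.of_nonneg (CFC.abs_nonneg T))
  have h : ⟪CFC.abs T x, CFC.abs T x⟫_ℂ = ⟪T x, T x⟫_ℂ := by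
    have h2 : CFC.abs T (CFC.abs T x) = ContinuousLinearMap.adjoint T (T x) :=
      congrArg (fun S : H →L[ℂ] H => S x) (CFC.abs_mul_abs T)
    rw [← ContinuousLinearMap.adjoint_inner_right, hsa, h2,
      ContinuousLinearMap.adjoint_inner_right]
  rw [inner_self_eq_norm_sq_to_K, inner_self_eq_norm_sq_to_K] at h
  have h' : ‖CFC.abs T x‖ ^ 2 = ‖T x‖ ^ 2 := by exact_mod_cast h
  exact (sq_eq_sq₀ (norm_nonneg _) (norm_nonneg _)).1 h'

/-- By Parseval both sums equal the double series of `|⟪b j, R b i⟫|²`, summed in the two orders. -/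
theorem summable_norm_sq_adjoint {ι : Type*} (b : HilbertBasis ι ℂ H) {R : H →L[ℂ] H}
    (h : Summable fun i => ‖R (b i)‖ ^ 2) :
    Summable fun i => ‖ContinuousLinearMap.adjoint R (b i)‖ ^ 2 := by
  have key : ∀ x : H, HasSum (fun j => ‖⟪b j, x⟫_ℂ‖ ^ 2) (‖x‖ ^ 2) := by
    intro x
    have h1 := b.hasSum_inner_mul_inner x x
    rw [inner_self_eq_norm_sq_to_K] at h1
    have h2 := Complex.hasSum_re h1
    convert h2 using 1
    · ext j
      rw [← inner_conj_symm x (b j), mul_comm, Complex.mul_conj, Complex.normSq_eq_norm_sq]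
      exact (Complex.ofReal_re _).symm
    · norm_cast
  let f : ι × ι → ℝ := fun p => ‖⟪b p.2, R (b p.1)⟫_ℂ‖ ^ 2
  have hf : 0 ≤ f := fun p => sq_nonneg _
  have hf' : 0 ≤ fun p : ι × ι => f p.swap := fun p => hf p.swap
  have h1 : Summable f := by
    rw [summable_prod_of_nonneg hf]
    exact ⟨fun i => (key (R (b i))).summable, h.congr fun i => ((key (R (b i))).tsum_eq).symm⟩
  have h2 := ((summable_prod_of_nonneg hf').1 h1.prod_symm).2
  refine h2.congr fun j => ?_
  rw [← (key (ContinuousLinearMap.adjoint R (b j))).tsum_eq]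
  refine tsum_congr fun i => ?_
  change ‖⟪b j, R (b i)⟫_ℂ‖ ^ 2 = _
  rw [ContinuousLinearMap.adjoint_inner_right, ← inner_conj_symm, RCLike.norm_conj]

/-- Write `T = U R R` with `R = |T|^(1/2)` Hilbert–Schmidt. With `C = B U` the terms are `⟪R C* b i,
R b i⟫`, dominated by sums of two summable squares. -/
theorem IsTraceClass.summable_inner_comp {T : H →L[ℂ] H} (hT : IsTraceClass T)
    {w : Set H} (b : HilbertBasis w ℂ H) (B : H →L[ℂ] H) :
    Summable fun i => ⟪b i, B (T (b i))⟫_ℂ := by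
  obtain ⟨U, hU⟩ := exists_factor_of_norm_le T (CFC.abs T) fun x => (norm_abs_apply T x).ge
  set R : H →L[ℂ] H := CFC.sqrt (CFC.abs T) with hR
  have hRsa : ContinuousLinearMap.adjoint R = R :=
    IsSelfAdjoint.of_nonneg (CFC.sqrt_nonneg _)
  have hRR : ∀ x, R (R x) = CFC.abs T x := fun x =>
    congrArg (fun S : H →L[ℂ] H => S x) (CFC.sqrt_mul_sqrt_self (CFC.abs T) (CFC.abs_nonneg T))
  have hRsum : Summable fun i => ‖R (b i)‖ ^ 2 := by
    refine (hT w b).congr fun i => ?_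
    rw [← hRR, ← ContinuousLinearMap.adjoint_inner_left, hRsa, inner_self_eq_norm_sq_to_K]
    norm_cast
  set C : H →L[ℂ] H := B ∘L U with hC
  have hCsum : Summable fun i => ‖R (ContinuousLinearMap.adjoint C (b i))‖ ^ 2 := by
    have h1 : Summable fun i => ‖(C ∘L R) (b i)‖ ^ 2 := by
      refine Summable.of_nonneg_of_le (fun i => by positivity) (fun i => ?_)
        (hRsum.mul_left (‖C‖ ^ 2))
      rw [← mul_pow]
      exact pow_le_pow_left₀ (norm_nonneg _) (C.le_opNorm _) 2
    have h2 := summable_norm_sq_adjoint b h1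
    rw [ContinuousLinearMap.adjoint_comp, hRsa] at h2
    exact h2
  refine Summable.of_norm_bounded (hCsum.add hRsum) fun i => ?_
  have : ⟪b i, B (T (b i))⟫_ℂ = ⟪R (ContinuousLinearMap.adjoint C (b i)), R (b i)⟫_ℂ := by
    rw [hU, ← hRR]
    change ⟪b i, C (R (R (b i)))⟫_ℂ = _
    rw [← ContinuousLinearMap.adjoint_inner_left, ← ContinuousLinearMap.adjoint_inner_left, hRsa]
  rw [this]
  refine (norm_inner_le_norm _ _).trans ?_
  nlinarith [sq_nonneg (‖R (ContinuousLinearMap.adjoint C (b i))‖ - ‖R (b i)‖),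
    sq_nonneg (‖R (ContinuousLinearMap.adjoint C (b i))‖), sq_nonneg (‖R (b i)‖)]

/-- Converse of the preceding lemma, since `|T| = B T` for some bounded `B`. Unlike `|T|`, this
criterion is linear in `T`. -/
theorem isTraceClass_of_summable {T : H →L[ℂ] H}
    (h : ∀ (w : Set H) (b : HilbertBasis w ℂ H) (B : H →L[ℂ] H),
      Summable fun i => ⟪b i, B (T (b i))⟫_ℂ) : IsTraceClass T := by
  intro w b
  obtain ⟨B, hB⟩ := exists_factor_of_norm_le (CFC.abs T) T fun x => (norm_abs_apply T x).le
  simp only [hB]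
  exact (Complex.hasSum_re (h w b B).hasSum).summable

theorem IsTraceClass.add {S T : H →L[ℂ] H} (hS : IsTraceClass S) (hT : IsTraceClass T) :
    IsTraceClass (S + T) :=
  isTraceClass_of_summable fun _ b B => by
    simpa [inner_add_right] using (hS.summable_inner_comp b B).add (hT.summable_inner_comp b B)

theorem IsTraceClass.smul {T : H →L[ℂ] H} (hT : IsTraceClass T) (c : ℂ) :
    IsTraceClass (c • T) :=
  isTraceClass_of_summable fun _ b B => by
    simpa [inner_smul_right] using (hT.summable_inner_comp b B).mul_left c

theorem isTraceClass_rankOne (x y : H) : IsTraceClass (InnerProductSpace.rankOne ℂ x y) :=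
  isTraceClass_of_summable fun _ b B => by
    simpa [inner_smul_right] using b.summable_inner_mul_inner y (B x)

theorem IsTraceClassLin.add {S T : H →ₗ[ℂ] H} (hS : IsTraceClassLin S)
    (hT : IsTraceClassLin T) : IsTraceClassLin (S + T) := by
  obtain ⟨S', hS', hS⟩ := hS
  obtain ⟨T', hT', hT⟩ := hT
  exact ⟨S' + T', fun x => by simp [hS', hT'], hS.add hT⟩

theorem IsTraceClassLin.smul {T : H →ₗ[ℂ] H} (hT : IsTraceClassLin T) (c : ℂ) :
    IsTraceClassLin (c • T) := by
  obtain ⟨T', hT', hT⟩ := hT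
  exact ⟨c • T', fun x => by simp [hT'], hT.smul c⟩

theorem IsTraceClassLin.summable_inner {T : H →ₗ[ℂ] H} (hT : IsTraceClassLin T)
    {w : Set H} (b : HilbertBasis w ℂ H) : Summable fun i => ⟪b i, T (b i)⟫_ℂ := by
  obtain ⟨T', hT', hT⟩ := hT
  simpa [hT'] using hT.summable_inner_comp b (ContinuousLinearMap.id ℂ H)

theorem trace_add {S T : H →ₗ[ℂ] H} (hS : IsTraceClassLin S) (hT : IsTraceClassLin T) :
    trace (S + T) = trace S + trace T := by
  simp only [trace, LinearMap.add_apply, inner_add_right]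
  exact (hS.summable_inner _).tsum_add (hT.summable_inner _)

theorem trace_smul (c : ℂ) (T : H →ₗ[ℂ] H) : trace (c • T) = c * trace T := by
  simp only [trace, LinearMap.smul_apply, inner_smul_right]
  exact tsum_mul_left

theorem trace_rankOne (x y : H) :
    trace ((InnerProductSpace.rankOne ℂ x y : H →L[ℂ] H) : H →ₗ[ℂ] H) = ⟪y, x⟫_ℂ := by
  rw [← (stdBasis H).tsum_inner_mul_inner y x]
  simp [trace]

end TraceClass

/-! ### Convexity of the state space, vector states and the zeros of `a_Q`. -/

section States

variable {H : Type*} [NormedAddCommGroup H] [InnerProductSpace ℂ H] [CompleteSpace H]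
  {D : Submodule ℂ H} {M : OStarAlgebra D}

/-- A positive operator of trace one with range in `D`, all of whose products with elements of `M`
are trace class, is a state. -/
theorem exists_state (M : OStarAlgebra D) (T : H →L[ℂ] H) (hpos : T.IsPositive)
    (hrange : ∀ x, T x ∈ D)
    (htr : trace (T : H →ₗ[ℂ] H) = 1)
    (hmul : ∀ A ∈ M.carrier, IsTraceClassLin (mulOp A T hrange)) :
    ∃ ρ : StateSpace M, ρ.op = T := by
  have hadj : ContinuousLinearMap.adjoint T = T := hpos.isSelfAdjoint
  have hadj_range : ∀ x, ContinuousLinearMap.adjoint T x ∈ D := by rwa [hadj]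
  have heq : ∀ A : Module.End ℂ D,
      mulOp A (ContinuousLinearMap.adjoint T) hadj_range = mulOp A T hrange := by
    intro A
    congr!
  obtain ⟨S, hS, hStc⟩ := hmul 1 M.carrier.one_mem
  have hST : S = T := by
    ext x
    exact hS x
  exact ⟨⟨T, ⟨hST ▸ hStc, hrange, hadj_range, hmul, fun A hA => heq A ▸ hmul A hA⟩, hpos, htr⟩, rfl⟩

theorem isTraceClassLin_op (ρ : StateSpace M) : IsTraceClassLin (ρ.op : H →ₗ[ℂ] H) :=
  ⟨ρ.op, fun _ => rfl, ρ.memT1.traceClass⟩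

theorem expect_congr {ρ : StateSpace M} {T : H →L[ℂ] H} (h : ρ.op = T) (hT : ∀ x, T x ∈ D)
    (A : M.carrier) : expect ρ A = trace (mulOp (A : Module.End ℂ D) T hT) := by
  subst h
  rfl

theorem exists_convexCombination (ρ σ : StateSpace M) (t : ℝ) (h0 : 0 ≤ t) (h1 : t ≤ 1) :
    ∃ τ : StateSpace M, ∀ A : M.carrier,
      expect τ A = ((1 - t : ℝ) : ℂ) * expect ρ A + (t : ℂ) * expect σ A := by
  set T : H →L[ℂ] H := ((1 - t : ℝ) : ℂ) • ρ.op + (t : ℂ) • σ.op with hT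
  have hpos : T.IsPositive :=
    (ρ.isPositive.smul_of_nonneg (by exact_mod_cast sub_nonneg.2 h1)).add
      (σ.isPositive.smul_of_nonneg (by exact_mod_cast h0))
  have hrange : ∀ x, T x ∈ D := fun x =>
    D.add_mem (D.smul_mem _ (ρ.memT1.range_mem x)) (D.smul_mem _ (σ.memT1.range_mem x))
  have hmulOp : ∀ A : Module.End ℂ D, mulOp A T hrange =
      ((1 - t : ℝ) : ℂ) • mulOp A ρ.op ρ.memT1.range_mem
        + (t : ℂ) • mulOp A σ.op σ.memT1.range_mem := by
    intro A
    ext x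
    have : (⟨T x, hrange x⟩ : D) = ((1 - t : ℝ) : ℂ) • ⟨ρ.op x, ρ.memT1.range_mem x⟩
        + (t : ℂ) • ⟨σ.op x, σ.memT1.range_mem x⟩ := rfl
    change ((A ⟨T x, hrange x⟩ : D) : H) = _
    rw [this, map_add, map_smul, map_smul]
    rfl
  have htr : trace (T : H →ₗ[ℂ] H) = 1 := by
    have : (T : H →ₗ[ℂ] H) =
        ((1 - t : ℝ) : ℂ) • (ρ.op : H →ₗ[ℂ] H) + (t : ℂ) • (σ.op : H →ₗ[ℂ] H) := rfl
    rw [this, trace_add ((isTraceClassLin_op ρ).smul _) ((isTraceClassLin_op σ).smul _),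
      trace_smul, trace_smul, ρ.trace_eq_one, σ.trace_eq_one]
    push_cast
    ring
  obtain ⟨τ, hτ⟩ := exists_state M T hpos hrange htr fun A hA => by
    rw [hmulOp]
    exact ((ρ.memT1.mul_traceClass A hA).smul _).add ((σ.memT1.mul_traceClass A hA).smul _)
  refine ⟨τ, fun A => ?_⟩
  rw [expect_congr hτ hrange, hmulOp,
    trace_add ((ρ.memT1.mul_traceClass A A.2).smul _) ((σ.memT1.mul_traceClass A A.2).smul _),
    trace_smul, trace_smul]
  rfl

theorem exists_vectorState (M : OStarAlgebra D) (φ : D) (hφ : ‖φ‖ = 1) :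
    ∃ ρ : StateSpace M, ∀ A : M.carrier,
      expect ρ A = ⟪(φ : H), (((A : Module.End ℂ D) φ : D) : H)⟫_ℂ := by
  set T : H →L[ℂ] H := InnerProductSpace.rankOne ℂ (φ : H) (φ : H) with hT
  have hrange : ∀ x, T x ∈ D := fun x => D.smul_mem _ φ.2
  have hmulOp : ∀ A : Module.End ℂ D, mulOp A T hrange =
      ((InnerProductSpace.rankOne ℂ ((A φ : D) : H) (φ : H) : H →L[ℂ] H) : H →ₗ[ℂ] H) := by
    intro A
    ext x
    have : (⟨T x, hrange x⟩ : D) = ⟪(φ : H), x⟫_ℂ • φ := rfl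
    change ((A ⟨T x, hrange x⟩ : D) : H) = _
    rw [this, map_smul]
    rfl
  obtain ⟨ρ, hρ⟩ := exists_state M T (InnerProductSpace.isPositive_rankOne_self _) hrange
    (by
      rw [trace_rankOne, inner_self_eq_norm_sq_to_K]
      have : ‖(φ : H)‖ = 1 := hφ
      simp [this])
    (fun A _ => by
      rw [hmulOp]
      exact ⟨_, fun _ => rfl, isTraceClass_rankOne _ _⟩)
  exact ⟨ρ, fun A => by rw [expect_congr hρ hrange, hmulOp, trace_rankOne]⟩

/-- Every open set containing `ρ` contains a proper convex combination of `ρ` and `σ`. -/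
theorem exists_mem_convexCombination {U : Set (StateSpace M)} (hU : IsOpen U)
    {ρ : StateSpace M} (hρ : ρ ∈ U) (σ : StateSpace M) :
    ∃ t : ℝ, 0 < t ∧ ∃ τ ∈ U, ∀ A : M.carrier,
      expect τ A = ((1 - t : ℝ) : ℂ) * expect ρ A + (t : ℂ) * expect σ A := by
  obtain ⟨O, hO, rfl⟩ := isOpen_induced_iff.1 hU
  have hcont : Continuous fun (t : ℝ) (A : M.carrier) =>
      ((1 - t : ℝ) : ℂ) * expect ρ A + (t : ℂ) * expect σ A := by
    fun_prop
  -- The segment starts at `ρ`, so it stays in `O` for small `t`.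
  have hmem : ∀ᶠ t in 𝓝 (0 : ℝ), (fun A : M.carrier =>
      ((1 - t : ℝ) : ℂ) * expect ρ A + (t : ℂ) * expect σ A) ∈ O := by
    refine hcont.continuousAt.eventually_mem (hO.mem_nhds ?_)
    simpa using hρ
  obtain ⟨t, ht, h0, h1⟩ := ((hmem.filter_mono nhdsWithin_le_nhds).and
    (Ioc_mem_nhdsGT (zero_lt_one' ℝ))).exists
  obtain ⟨τ, hτ⟩ := exists_convexCombination ρ σ t h0.le h1
  refine ⟨t, h0, τ, ?_, hτ⟩
  change (expect τ : M.carrier → ℂ) ∈ O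
  rwa [funext hτ]

theorem IsEssSelfAdjoint.isSymmetric (hD : Dense (D : Set H)) {A : Module.End ℂ D}
    (hA : IsEssSelfAdjoint A) : A.IsSymmetric := by
  intro φ ψ
  set C := (toLinearPMap A).closure with hC
  have hle : toLinearPMap A ≤ C := (toLinearPMap A).le_closure
  have hdense : Dense (C.domain : Set H) := hD.mono hle.1
  have hsa : C.adjoint = C := hA.2
  have hformal : C.IsFormalAdjoint C := by
    have := LinearPMap.adjoint_isFormalAdjoint hdense
    rwa [hsa] at this
  have hval : ∀ χ : D, C ⟨χ, hle.1 χ.2⟩ = ((A χ : D) : H) := fun χ =>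
    (hle.2 (x := χ) (y := ⟨χ, hle.1 χ.2⟩) rfl).symm
  have := hformal ⟨φ, hle.1 φ.2⟩ ⟨ψ, hle.1 ψ.2⟩
  rwa [hval, hval] at this

theorem aQ_zero (ρ : StateSpace M) : aQ (0 : M.carrier) ρ = 0 := by
  change (expect ρ 0).re = 0
  have : expect ρ 0 = 0 := by simp [expect, trace, mulOp]
  simp [this]

/-- The zeros of `a_Q` have empty interior unless `A` is zero. -/
theorem dense_aQ_ne_zero (hD : Dense (D : Set H)) {A : M.carrier}
    (hA : IsEssSelfAdjoint (A : Module.End ℂ D)) (hA0 : A ≠ 0) : Dense {ρ | aQ A ρ ≠ 0} := by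
  by_contra hdense
  obtain ⟨U, hU, ⟨ρ, hρ⟩, hzero⟩ : ∃ U : Set (StateSpace M), IsOpen U ∧ U.Nonempty ∧
      ∀ ρ ∈ U, aQ A ρ = 0 := by
    rw [dense_iff_inter_open] at hdense
    push Not at hdense
    obtain ⟨U, hU, hne, hemp⟩ := hdense
    refine ⟨U, hU, hne, fun ρ hρ => ?_⟩
    by_contra h
    have : ρ ∈ U ∩ {ρ | aQ A ρ ≠ 0} := ⟨hρ, h⟩
    simp [hemp] at this
  have hall : ∀ σ : StateSpace M, aQ A σ = 0 := by
    intro σ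
    obtain ⟨t, ht, τ, hτU, hτ⟩ := exists_mem_convexCombination hU hρ σ
    have h1 : (expect τ A).re = 0 := hzero τ hτU
    have h2 : (expect ρ A).re = 0 := hzero ρ hρ
    rw [hτ, Complex.add_re, Complex.re_ofReal_mul, Complex.re_ofReal_mul, h2, mul_zero,
      zero_add] at h1
    exact (mul_eq_zero.1 h1).resolve_left ht.ne'
  have hsymm := hA.isSymmetric hD
  have hunit : ∀ φ : D, ‖φ‖ = 1 → ⟪(A : Module.End ℂ D) φ, φ⟫_ℂ = 0 := by
    intro φ hφ
    obtain ⟨σ, hσ⟩ := exists_vectorState M φ hφ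
    have h1 : (expect σ A).re = 0 := hall σ
    rw [hσ] at h1
    have h2 : (⟪φ, (A : Module.End ℂ D) φ⟫_ℂ).re = 0 := h1
    rw [← hsymm φ φ] at h2
    exact Complex.ext h2 (hsymm.im_inner_apply_self φ)
  -- Over `ℂ`, an operator with zero quadratic form is zero; unit vectors suffice by scaling.
  refine hA0 (Subtype.ext ((inner_map_self_eq_zero _).1 fun φ => ?_))
  by_cases hφ : φ = 0
  · simp [hφ]
  have hn : (‖φ‖ : ℂ) ≠ 0 := by simpa using hφ
  have h := hunit ((‖φ‖⁻¹ : ℂ) • φ) (by simp [norm_smul, hφ])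
  rw [map_smul, inner_smul_left, inner_smul_right] at h
  simpa [hn, hφ] using h

end States

/-! ### Convergence of restrictions of one continuous function to varying open sets. -/

namespace RealNumber

variable {X : Type*} [TopologicalSpace X]

theorem distLT_restrictTo_iff (h : C(X, ℝ)) (U V : Opens X) {ε : ℝ} (hε : 0 < ε) :
    DistLT (restrictTo h U) (restrictTo h V) ε ↔
      (∀ x ∈ U, x ∉ closure (V : Set X) → |h x| < ε) ∧
        ∀ x ∈ V, x ∉ closure (U : Set X) → |h x| < ε := by
  have hin : ∀ (W : Opens X) (x : X), x ∈ W → (restrictTo h W).prolong x = h x :=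
    fun W x hx => dif_pos hx
  have hout : ∀ (W : Opens X) (x : X), x ∉ W → (restrictTo h W).prolong x = 0 :=
    fun W x hx => dif_neg hx
  have hdiff : ∀ (U V : Opens X) (x : X), x ∈ interior ((U : Set X) \ V) ↔
      x ∈ U ∧ x ∉ closure (V : Set X) := by
    intro U V x
    rw [Set.sdiff_eq, interior_inter, U.isOpen.interior_eq, interior_compl]
    rfl
  constructor
  · intro hd
    refine ⟨fun x hx hxV => ?_, fun x hx hxU => ?_⟩
    · have h1 := hd x (Or.inl (Or.inl (Or.inr ((hdiff U V x).2 ⟨hx, hxV⟩))))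
      rwa [distFun, hin U x hx, hout V x fun hV => hxV (subset_closure hV), sub_zero] at h1
    · have h1 := hd x (Or.inl (Or.inr ((hdiff V U x).2 ⟨hx, hxU⟩)))
      rwa [distFun, hin V x hx, hout U x fun hV => hxU (subset_closure hV), zero_sub,
        abs_neg] at h1
  · rintro ⟨hUV, hVU⟩ x (((hx | hx) | hx) | hx)
    · have h1 := interior_subset hx
      rw [distFun, hin U x h1.1, hin V x h1.2, sub_self, abs_zero]
      exact hε
    · obtain ⟨h1, h2⟩ := (hdiff U V x).1 hx
      rw [distFun, hin U x h1, hout V x fun hV => h2 (subset_closure hV), sub_zero]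
      exact hUV x h1 h2
    · obtain ⟨h1, h2⟩ := (hdiff V U x).1 hx
      rw [distFun, hin V x h1, hout U x fun hV => h2 (subset_closure hV), zero_sub, abs_neg]
      exact hVU x h1 h2
    · have h1 := interior_subset hx
      rw [distFun, hout U x fun h => h1 (Or.inl h), hout V x fun h => h1 (Or.inr h), sub_self,
        abs_zero]
      exact hε

/-- Being in the open set `O`, off the closure of `V`, with `|g|` above `c`, is an open condition,
so it holds at some point of every set `S` whose closure contains such a point. -/
theorem exists_mem_near {O : Set X} (hO : IsOpen O) (V : Opens X) (g : C(X, ℝ)) {c : ℝ} {x : X}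
    (hx : x ∈ O) (hxV : x ∉ closure (V : Set X)) (hc : c < |g x|) {S : Set X}
    (hS : x ∈ closure S) : ∃ y ∈ S, y ∈ O ∧ y ∉ closure (V : Set X) ∧ c < |g y| := by
  have hopen : IsOpen (O ∩ (closure (V : Set X))ᶜ ∩ {y | c < |g y|}) :=
    (hO.inter isClosed_closure.isOpen_compl).inter
      (isOpen_lt continuous_const g.continuous.abs)
  obtain ⟨y, ⟨⟨h1, h2⟩, h3⟩, h4⟩ := mem_closure_iff.1 hS _ hopen ⟨⟨hx, hxV⟩, hc⟩
  exact ⟨y, h4, h1, h2, h3⟩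

/-- A violation at stage `k` can be moved to a point `y` with `a y ≠ 0`. One hypothesis then puts
`y` in the closure of a late `V k'`, and a point of `V k'` near `y` contradicts the other. -/
theorem ConvergesTo.of_isCauchy {a g : C(X, ℝ)} (ha : Dense {x | a x ≠ 0}) {V : ℕ → Opens X}
    {W : Opens X} (hconv : ConvergesTo (fun k => restrictTo a (V k)) (restrictTo a W))
    (hcauchy : IsCauchy fun k => restrictTo g (V k)) :
    ConvergesTo (fun k => restrictTo g (V k)) (restrictTo g W) := by
  intro ε hε
  -- Halving turns `ε ≤ |g x|` into the strict, hence open, condition `ε / 2 < |g x|`.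
  obtain ⟨K, hK⟩ := hcauchy (ε / 2) (half_pos hε)
  refine ⟨K, fun k hk => (distLT_restrictTo_iff g (V k) W hε).2 ⟨fun x hx hxW => ?_,
    fun x hx hxV => ?_⟩⟩ <;> by_contra! hlt <;> replace hlt : ε / 2 < |g x| := by linarith
  · obtain ⟨y, hya, hyV, hyW, hyg⟩ := exists_mem_near (V k).isOpen W g hx hxW hlt (ha x)
    have hay : 0 < |a y| := abs_pos.2 hya
    obtain ⟨L, hL⟩ := hconv (|a y| / 2) (half_pos hay)
    set k' := max K L + 1
    have hcl : y ∈ closure (V k' : Set X) := by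
      by_contra hy
      exact lt_asymm hyg (((distLT_restrictTo_iff g _ _ (half_pos hε)).1
        (hK k k' hk (by omega))).1 y hyV hy)
    obtain ⟨z, hzV, -, hzW, hza⟩ := exists_mem_near (V k).isOpen W a hyV hyW
      (half_lt_self hay) hcl
    exact lt_asymm hza (((distLT_restrictTo_iff a _ _ (half_pos hay)).1
      (hL k' (by omega))).1 z hzV hzW)
  · obtain ⟨y, hya, hyW, hyV, hyg⟩ := exists_mem_near W.isOpen (V k) g hx hxV hlt (ha x)
    have hay : 0 < |a y| := abs_pos.2 hya
    obtain ⟨L, hL⟩ := hconv |a y| hay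
    set k' := max K L + 1
    have hcl : y ∈ closure (V k' : Set X) := by
      by_contra hy
      exact lt_irrefl _ (((distLT_restrictTo_iff a _ _ hay).1
        (hL k' (by omega))).2 y hyW hy)
    obtain ⟨z, hzV', -, hzV, hzg⟩ := exists_mem_near W.isOpen (V k) g hyW hyV hyg hcl
    exact lt_asymm hzg (((distLT_restrictTo_iff g _ _ (half_pos hε)).1
      (hK k' k (by omega) hk)).1 z hzV' hzV)

theorem IsCauchy.exists_convergesTo {a : C(X, ℝ)} {V : ℕ → Opens X}
    (h : IsCauchy fun k => restrictTo a (V k)) :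
    ∃ W : Opens X, ConvergesTo (fun k => restrictTo a (V k)) (restrictTo a W) := by
  choose K hK using fun n : ℕ => h (1 / ((n : ℝ) + 1)) Nat.one_div_pos_of_nat
  let O : ℕ → Opens X := fun n =>
    ⟨{x | 1 / ((n : ℝ) + 1) < |a x|}, isOpen_lt continuous_const a.continuous.abs⟩
  -- `N n > K n` gives accuracy `1 / (n + 1)`, the threshold in `O n`; `N n > n` makes the chosen
  -- index pass any bound `L`.
  let N : ℕ → ℕ := fun n => max n (K n) + 1
  refine ⟨⨆ n, O n ⊓ V (N n), fun ε hε => ?_⟩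
  obtain ⟨L, hL⟩ := h (ε / 2) (half_pos hε)
  refine ⟨L, fun k hk => (distLT_restrictTo_iff a (V k) _ hε).2 ⟨fun x hx hxW => ?_,
    fun x hx hxV => ?_⟩⟩ <;> by_contra! hlt <;> replace hlt : ε / 2 < |a x| := by linarith
  · obtain ⟨n₀, hn₀⟩ := exists_nat_one_div_lt (half_pos hε)
    set n := max n₀ L with hn
    have hnx : 1 / ((n : ℝ) + 1) < |a x| :=
      ((Nat.one_div_le_one_div (le_max_left n₀ L)).trans_lt hn₀).trans hlt
    have hcl : x ∈ closure (V (N n) : Set X) := by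
      by_contra hy
      exact lt_asymm hlt (((distLT_restrictTo_iff a _ _ (half_pos hε)).1
        (hL k (N n) hk (by simp only [N]; omega))).1 x hx hy)
    obtain ⟨z, hzV, -, hzW, hza⟩ := exists_mem_near (V k).isOpen _ a hx hxW hnx hcl
    exact hzW (subset_closure (Opens.mem_iSup.2 ⟨n, hza, hzV⟩))
  · obtain ⟨n, hxO, hxN⟩ := Opens.mem_iSup.1 hx
    have hxO' : 1 / ((n : ℝ) + 1) < |a x| := hxO
    set k' := max (K n) L + 1
    have hcl : x ∈ closure (V k' : Set X) := by
      by_contra hy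
      exact lt_asymm hxO' (((distLT_restrictTo_iff a _ _ Nat.one_div_pos_of_nat).1
        (hK n (N n) k' (by simp only [N]; omega) (by omega))).1 x hxN hy)
    obtain ⟨z, hzV', -, hzV, hza⟩ := exists_mem_near (O n).isOpen (V k) a hxO hxV hlt hcl
    exact lt_asymm hza (((distLT_restrictTo_iff a _ _ (half_pos hε)).1
      (hL k' k (by omega) hk)).1 z hzV' hzV)

/-- If `a` is zero, one member of the sequence is a limit for all `F(a)` simultaneously. -/
theorem exists_convergesTo_map_of_eq_zero {a : C(X, ℝ)} (ha : ∀ x, a x = 0) (V : ℕ → Opens X) :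
    ∃ W : Opens X, ConvergesTo (fun k => restrictTo a (V k)) (restrictTo a W) ∧
      ∀ F : C(ℝ, ℝ), IsCauchy (fun k => (restrictTo a (V k)).map F) →
        ConvergesTo (fun k => (restrictTo a (V k)).map F) ((restrictTo a W).map F) := by
  have htriv : ∀ (g : C(X, ℝ)) (W : Opens X), (∀ x, g x = 0) →
      ConvergesTo (fun k => restrictTo g (V k)) (restrictTo g W) := fun g W hg ε hε =>
    ⟨0, fun k _ => (distLT_restrictTo_iff g _ _ hε).2
      ⟨fun x _ _ => by simpa [hg] using hε, fun x _ _ => by simpa [hg] using hε⟩⟩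
  have hF : ∀ (F : C(ℝ, ℝ)) (x : X), F.comp a x = F 0 := fun F x => by
    simp [ha]
  -- Here `F(a)` is the constant `F 0`. If `F 0 ≠ 0`, being Cauchy at accuracy `|F 0|` is exactly
  -- this stability of extents; if it fails, only `F 0 = 0` remains and any `W` works.
  by_cases hstable : ∃ K : ℕ, ∀ k k' : ℕ, K < k → K < k' →
      ∀ x ∈ V k, x ∈ closure (V k' : Set X)
  · obtain ⟨K, hK⟩ := hstable
    refine ⟨V (K + 1), htriv a _ ha, fun F _ ε hε => ⟨K, fun k hk =>
      (distLT_restrictTo_iff (F.comp a) _ _ hε).2 ⟨fun x hx hx' => ?_, fun x hx hx' => ?_⟩⟩⟩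
    · exact absurd (hK k (K + 1) hk (by omega) x hx) hx'
    · exact absurd (hK (K + 1) k (by omega) hk x hx) hx'
  · refine ⟨⊥, htriv a _ ha, fun F hcauchy => ?_⟩
    by_cases hF0 : F 0 = 0
    · exact htriv (F.comp a) _ fun x => (hF F x).trans hF0
    · refine absurd ?_ hstable
      obtain ⟨K, hK⟩ := hcauchy |F 0| (abs_pos.2 hF0)
      refine ⟨K, fun k k' hk hk' x hx => ?_⟩
      by_contra hx'
      have := ((distLT_restrictTo_iff (F.comp a) _ _ (abs_pos.2 hF0)).1 (hK k k' hk hk')).1 x hx hx'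
      rw [hF] at this
      exact lt_irrefl _ this

end RealNumber

theorem isLocallyLinear_restrictTo_aQ {H : Type*} [NormedAddCommGroup H] [InnerProductSpace ℂ H]
    [CompleteSpace H] {D : Submodule ℂ H} {M : OStarAlgebra D} {A : M.carrier}
    (hA : IsEssSelfAdjoint (A : Module.End ℂ D)) (W : Opens (StateSpace M)) :
    IsLocallyLinear (restrictTo (aQ A) W) :=
  fun _ hρ => ⟨W, hρ, le_rfl, A, hA, fun _ _ _ => rfl⟩

end QR

theorem lemma30 {H : Type*} [NormedAddCommGroup H] [InnerProductSpace ℂ H] [CompleteSpace H]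
    {D : Submodule ℂ H} (hD : Dense (D : Set H)) (M : QR.OStarAlgebra D)
    (A : M.carrier) (hA : QR.IsEssSelfAdjoint (A : Module.End ℂ D)) :
    (∀ V : ℕ → Opens (QR.StateSpace M),
      QR.RealNumber.IsCauchy (fun k => QR.restrictTo (QR.aQ A) (V k)) →
      ∃ W : Opens (QR.StateSpace M),
        QR.IsLocallyLinear (QR.restrictTo (QR.aQ A) W) ∧
        QR.RealNumber.ConvergesTo (fun k => QR.restrictTo (QR.aQ A) (V k))
          (QR.restrictTo (QR.aQ A) W) ∧
        ∀ F : C(ℝ, ℝ),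
          QR.RealNumber.IsCauchy (fun k => (QR.restrictTo (QR.aQ A) (V k)).map F) →
          QR.RealNumber.ConvergesTo (fun k => (QR.restrictTo (QR.aQ A) (V k)).map F)
            ((QR.restrictTo (QR.aQ A) W).map F)) ∧
    (A ≠ 0 → ∀ (V : ℕ → Opens (QR.StateSpace M)) (W : Opens (QR.StateSpace M)) (F : C(ℝ, ℝ)),
      QR.RealNumber.ConvergesTo (fun k => QR.restrictTo (QR.aQ A) (V k))
        (QR.restrictTo (QR.aQ A) W) →
      QR.RealNumber.IsCauchy (fun k => (QR.restrictTo (QR.aQ A) (V k)).map F) →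
      QR.RealNumber.ConvergesTo (fun k => (QR.restrictTo (QR.aQ A) (V k)).map F)
        ((QR.restrictTo (QR.aQ A) W).map F)) := by
  -- `F(a(V))` is definitionally the restriction of `F ∘ a` to `V`, so `g = F ∘ a` applies.
  refine ⟨fun V hV => ?_, fun hA0 V W F hconv hcauchy =>
    QR.RealNumber.ConvergesTo.of_isCauchy (g := F.comp (QR.aQ A))
      (QR.dense_aQ_ne_zero hD hA hA0) hconv hcauchy⟩
  by_cases hA0 : A = 0
  · obtain ⟨W, hW, hWF⟩ := QR.RealNumber.exists_convergesTo_map_of_eq_zero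
      (a := QR.aQ A) (fun ρ => by rw [hA0]; exact QR.aQ_zero ρ) V
    exact ⟨W, QR.isLocallyLinear_restrictTo_aQ hA W, hW, hWF⟩
  · obtain ⟨W, hW⟩ := hV.exists_convergesTo
    exact ⟨W, QR.isLocallyLinear_restrictTo_aQ hA W, hW, fun F hcauchy =>
      QR.RealNumber.ConvergesTo.of_isCauchy (g := F.comp (QR.aQ A))
      (QR.dense_aQ_ne_zero hD hA hA0) hW hcauchy⟩
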